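/- A finite simple graph $G$ is a \emph{circular arc graph} if there is a function $\phi$ assigning to every vertex of $G$ an open arc of a circle such that, for every two distinct vertices $u$ and $w$, $uw$ is an edge of $G$ if and only if $\phi(u)\cap\phi(w)\neq\emptyset$. A path of $G$ is a \emph{longest path} if no path of $G$ has more vertices. \textbf{Theorem.} If $G$ is a connected circular arc graph, then the intersection of all longest paths of $G$ is nonempty, that is, there is a vertex of $G$ that lies on every longest path of $G$. -/

import Mathlib

/-- An open arc of the circle `ℝ / ℤ`: the image of a nonempty bounded open interval of `ℝ`.
Intervals of length more than `1` give the whole circle, which counts as an open arc. -/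
def IsOpenArc (A : Set UnitAddCircle) : Prop :=
  ∃ a b : ℝ, a < b ∧ A = (fun x : ℝ => (x : UnitAddCircle)) '' Set.Ioo a b

/-- A circular arc graph: vertices can be assigned open arcs of a circle (not necessarily pairwise
different) so that distinct vertices are adjacent exactly when their arcs meet. -/
def SimpleGraph.IsCircularArcGraph {V : Type*} (G : SimpleGraph V) : Prop :=
  ∃ φ : V → Set UnitAddCircle, (∀ v, IsOpenArc (φ v)) ∧
    ∀ u w : V, u ≠ w → (G.Adj u w ↔ (φ u ∩ φ w).Nonempty)

/-- A longest path: a path such that no path of the graph, between any two vertices, is longer. -/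
def SimpleGraph.Walk.IsLongestPath {V : Type*} {G : SimpleGraph V} {u v : V}
    (p : G.Walk u v) : Prop :=
  p.IsPath ∧ ∀ (x y : V) (q : G.Walk x y), q.IsPath → q.length ≤ p.length

/-! A longest path is closed under domination: with an arc it contains every arc including it.
Replacing each vertex of a walk through all of `G` by a maximal arc around it gives a sequence `K
i`, consecutive terms equal or adjacent, which every longest path meets. Take the least `b` such
that some longest path `P` avoids all terms after `K b`; then `K b` is the required vertex. If a
longest path `Q` misses it, let `K a` be the first later term in `Q`. By `exists_perm_of_overlap`,
`P` reorders as `C, e, X` with `e` adjacent to `K (b + 1)` and `C` inside `K b`; likewise `Q` as `D,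
f, Y` with `f` adjacent to `K (a - 1)` and `D` inside `K a`. Replacing `C` by `K (b + 1), ..., K a,
D` yields a path, so `D` is shorter than `C`; the mirror exchange gives the reverse inequality.

For the reordering, opening the circle at a missed maximal arc turns the path into one of an
interval graph, where `exists_perm_sorted` applies. -/

namespace List

/-! ### Rearranging paths of interval graphs. -/

variable {α : Type*} {R : α → α → Prop}

/-- Right-endpoint ordering property of interval graphs. -/
def IsIntervalKey (R : α → α → Prop) (key : α → ℝ) : Prop :=
  ∀ i j k, R i k → key i ≤ key j → key j ≤ key k → j ≠ k → R j k

theorem IsIntervalKey.rel_of_rel_min {key : α → ℝ} (h : IsIntervalKey R key)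
    (hs : ∀ a b, R a b → R b a) {u a b : α} (hua : R u a) (hub : R u b) (ha : key u ≤ key a)
    (hb : key u ≤ key b) (hab : a ≠ b) : R a b := by
  rcases le_total (key a) (key b) with hle | hle
  · exact h u a b hub ha hle hab
  · exact hs _ _ (h u b a hua hb hle hab.symm)

theorem IsIntervalKey.rel_of_rel_least {key : α → ℝ} (h : IsIntervalKey R key)
    (hs : ∀ a b, R a b → R b a) {u x b z : α} (hub : R u b) (hxb : key x ≤ key b)
    (hz : key u ≤ key z) (hxz : R x z) (hzb : z ≠ b) : R b z := by
  rcases le_total (key z) (key b) with hle | hle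
  · exact hs _ _ (h u z b hub hz hle hzb)
  · exact h x b z hxz hxb hle hzb.symm

theorem isChain_reverse_of_symm (hs : ∀ a b, R a b → R b a) {l : List α} (hl : l.IsChain R) :
    l.reverse.IsChain R :=
  isChain_reverse.2 (hl.imp fun a b => hs a b)

theorem IsChain.erase_min {key : α → ℝ} (h : IsIntervalKey R key)
    (hs : ∀ a b, R a b → R b a) {A B : List α} {u : α} (hnd : (A ++ u :: B).Nodup)
    (hc : (A ++ u :: B).IsChain R) (hmin : ∀ v ∈ A ++ u :: B, key u ≤ key v) :
    (A ++ B).IsChain R := by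
  obtain ⟨hA, huB, hj⟩ := isChain_append.1 hc
  refine isChain_append.2 ⟨hA, huB.tail, fun a ha b hb => ?_⟩
  have haA := mem_of_getLast? ha
  have hbB := mem_of_head? hb
  refine h.rel_of_rel_min hs (hs _ _ (hj a ha u (by simp))) ?_ (hmin a (by simp [haA]))
    (hmin b (by simp [hbB])) ?_
  · exact (List.isChain_cons.1 huB).1 b hb
  · rintro rfl
    exact (nodup_append.1 hnd).2.2 a haA a (by simp [hbB]) rfl

/-- Reversing `B` puts a neighbour of `u` next to a neighbour of `x` at each joint, and
`rel_of_rel_least` makes such pairs adjacent. -/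
theorem IsChain.erase_min_least {key : α → ℝ} (h : IsIntervalKey R key)
    (hs : ∀ a b, R a b → R b a) {A B C : List α} {u x : α}
    (hnd : (A ++ u :: (B ++ x :: C)).Nodup) (hc : (A ++ u :: (B ++ x :: C)).IsChain R)
    (hmin : ∀ v ∈ A ++ u :: (B ++ x :: C), key u ≤ key v)
    (hx : ∀ v ∈ A ++ u :: (B ++ x :: C), R u v → key x ≤ key v) :
    (A ++ (B.reverse ++ C)).IsChain R := by
  obtain ⟨hA, huB, hj⟩ := isChain_append.1 hc
  obtain ⟨huh, hBC⟩ := List.isChain_cons.1 huB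
  obtain ⟨hB, hxC, hBx⟩ := isChain_append.1 hBC
  obtain ⟨hxh, hC⟩ := List.isChain_cons.1 hxC
  have hA' : ∀ a ∈ A.getLast?, R u a := fun a ha => hs _ _ (hj a ha u (by simp))
  refine isChain_append.2 ⟨hA, isChain_append.2 ⟨isChain_reverse_of_symm hs hB, hC, ?_⟩, ?_⟩
  · intro b hb z hz
    have hb' : b ∈ B.head? := by simpa using hb
    have hbB := mem_of_head? hb'
    have hzC := mem_of_head? hz
    have hub : R u b := huh b (by
      cases B with
      | nil => simp at hb'
      | cons c B => simpa using hb')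
    refine h.rel_of_rel_least hs hub (hx b (by simp [hbB]) hub) (hmin z (by simp [hzC]))
      (hxh z hz) ?_
    rintro rfl
    grind
  · intro a ha y hy
    have haA := mem_of_getLast? ha
    have hxy : R x y ∧ y ∈ B ++ C := by
      rcases eq_nil_or_concat B with rfl | ⟨B', b, rfl⟩
      · have hy' : y ∈ C.head? := by simpa using hy
        exact ⟨hxh y hy', by simp [mem_of_head? hy']⟩
      · have : b = y := by simpa using hy
        subst this
        exact ⟨hs _ _ (hBx b (by simp) x (by simp)), by simp⟩
    have hyl : y ∈ A ++ u :: (B ++ x :: C) := by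
      have := hxy.2
      simp only [mem_append, mem_cons] at this ⊢
      tauto
    refine h.rel_of_rel_least hs (hA' a ha) (hx a (by simp [haA]) (hA' a ha)) (hmin y hyl) hxy.1 ?_
    rintro rfl
    have := hxy.2
    grind

/-- Removing a key-minimal vertex and its least neighbour from a path leaves a set
that is again spanned by a path. -/
theorem IsChain.exists_perm_erase_pair {key : α → ℝ} (h : IsIntervalKey R key)
    (hs : ∀ a b, R a b → R b a) {l : List α} {u x : α} (hnd : l.Nodup) (hc : l.IsChain R)
    (hu : u ∈ l) (hmin : ∀ v ∈ l, key u ≤ key v) (hxl : x ∈ l) (hxu : x ≠ u)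
    (hx : ∀ v ∈ l, R u v → key x ≤ key v) :
    ∃ l', (u :: x :: l') ~ l ∧ l'.IsChain R := by
  have key_case : ∀ m : List α, m ~ l → m.IsChain R → ∀ A B, m = A ++ u :: B → x ∈ B →
      ∃ l', (u :: x :: l') ~ l ∧ l'.IsChain R := by
    rintro m hm hmc A B rfl hxB
    obtain ⟨B, C, rfl⟩ := append_of_mem hxB
    refine ⟨A ++ (B.reverse ++ C), Perm.trans ?_ hm, IsChain.erase_min_least h hs
      (hm.nodup_iff.2 hnd) hmc (fun v hv => hmin v (hm.mem_iff.1 hv))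
      (fun v hv => hx v (hm.mem_iff.1 hv))⟩
    classical
    rw [perm_iff_count]
    intro a
    simp only [count_cons, count_append, count_reverse]
    ring
  obtain ⟨A, B, rfl⟩ := append_of_mem hu
  by_cases hxB : x ∈ B
  · exact key_case _ (Perm.refl _) hc A B rfl hxB
  · have hxA : x ∈ A := by simpa [hxu, hxB] using hxl
    exact key_case _ (reverse_perm _) (isChain_reverse_of_symm hs hc) B.reverse A.reverse
      (by simp) (by simpa using hxA)

/-- Every path of an interval graph can be rearranged, starting at a key-minimal vertex, so that
each vertex adjacent to all vertices of smaller key is preceded only by such vertices. -/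
theorem IsChain.exists_perm_sorted {key : α → ℝ} (h : IsIntervalKey R key)
    (hs : ∀ a b, R a b → R b a) (hirr : ∀ a, ¬ R a a) (l : List α) (hnd : l.Nodup)
    (hc : l.IsChain R)
    (u : α) (hu : u ∈ l) (hmin : ∀ v ∈ l, key u ≤ key v) :
    ∃ l', (u :: l') ~ l ∧ (u :: l').IsChain R ∧
      ∀ K ∈ l, (∀ v ∈ l, v ≠ K → key v ≤ key K → R K v) →
        ∀ A B, u :: l' = A ++ K :: B → ∀ v ∈ A, key v ≤ key K := by
  induction hn : l.length using Nat.strong_induction_on generalizing l u with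
  | _ n ih =>
  subst hn
  obtain ⟨A, B, hlAB⟩ := append_of_mem hu
  have hperm : (u :: (A ++ B)) ~ l := by rw [hlAB]; exact perm_middle.symm
  have hc1 : (A ++ B).IsChain R := by
    rw [hlAB] at hnd hc hmin
    exact hc.erase_min h hs hnd hmin
  have hnd1 : (u :: (A ++ B)).Nodup := hperm.nodup_iff.2 hnd
  have hlen1 : (A ++ B).length < l.length := by rw [← hperm.length_eq]; simp
  by_cases hnil : A ++ B = []
  · rw [hnil] at hperm
    refine ⟨[], hperm, .singleton u, fun K _ _ C D hCD v hv => ?_⟩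
    cases C with
    | nil => simp at hv
    | cons c C => simp at hCD
  have hnb : {x | x ∈ l ∧ R u x}.Nonempty := by
    rw [hlAB] at hc
    obtain ⟨hA, huB, hj⟩ := isChain_append.1 hc
    rcases eq_nil_or_concat A with rfl | ⟨A', a, rfl⟩
    · cases B with
      | nil => simp at hnil
      | cons b B => exact ⟨b, by simp [hlAB], (List.isChain_cons.1 huB).1 b (by simp)⟩
    · exact ⟨a, by simp [hlAB], hs _ _ (hj a (by simp) u (by simp))⟩
  have hfin : {x | x ∈ l ∧ R u x}.Finite :=
    (Set.Finite.subset (l.finite_toSet) (fun x hx => hx.1))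
  obtain ⟨x, ⟨hxl, hux⟩, hxmin⟩ := Set.exists_min_image _ key hfin hnb
  have hxu : x ≠ u := by rintro rfl; exact hirr _ hux
  have hx1 : x ∈ A ++ B := by
    have := hperm.mem_iff.2 hxl
    simpa [hxu] using this
  have huK : ∀ K ∈ l, K ≠ u → (∀ v ∈ l, v ≠ K → key v ≤ key K → R K v) → key x ≤ key K :=
    fun K hK hKu hun => hxmin K ⟨hK, hs _ _ (hun u hu hKu.symm (hmin K hK))⟩
  -- Greedy choice: go from `u` to its least neighbour `x`. If a smaller key remains, continue to
  -- the least remaining `w`, which is adjacent to `x` because its key lies between those of `u` and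
  -- `x`.
  by_cases hxm : ∀ v ∈ A ++ B, key x ≤ key v
  · obtain ⟨l', hp, hch, hK⟩ := ih _ hlen1 (A ++ B) (nodup_cons.1 hnd1).2 hc1 x hx1 hxm rfl
    refine ⟨x :: l', (hp.cons u).trans hperm, isChain_cons_cons.2 ⟨hux, hch⟩, ?_⟩
    intro K hKl hun C D hCD v hv
    cases C with
    | nil => simp at hv
    | cons c C =>
      obtain ⟨rfl, hCD₁⟩ : u = c ∧ x :: l' = C ++ K :: D := cons.inj hCD
      have hK1 : K ∈ A ++ B := hp.mem_iff.1 (by rw [hCD₁]; simp)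
      rcases mem_cons.1 hv with rfl | hv
      · exact hmin K hKl
      · exact hK K hK1 (fun w hw => hun w (hperm.mem_iff.1 (by simp [hw]))) C D hCD₁ v hv
  · push Not at hxm
    obtain ⟨v₀, hv₀, hv₀x⟩ := hxm
    obtain ⟨m, hm, hmc⟩ := hc.exists_perm_erase_pair h hs hnd hu hmin hxl hxu
      (fun v hv huv => hxmin v ⟨hv, huv⟩)
    have hml : ∀ w ∈ m, w ∈ l := fun w hw => hm.mem_iff.1 (by simp [hw])
    have hndm : (u :: x :: m).Nodup := hm.nodup_iff.2 hnd
    have hv₀m : v₀ ∈ m := by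
      have h1 := hm.mem_iff.2 (hperm.mem_iff.1 (mem_cons_of_mem u hv₀))
      have h2 : v₀ ≠ u := by rintro rfl; exact (nodup_cons.1 hnd1).1 hv₀
      have h3 : v₀ ≠ x := by rintro rfl; exact lt_irrefl _ hv₀x
      simpa [h2, h3] using h1
    obtain ⟨w, hwm, hwmin⟩ := Set.exists_min_image {v | v ∈ m} key m.finite_toSet ⟨v₀, hv₀m⟩
    have hxw : R x w := by
      refine hs _ _ (h u w x hux (hmin w (hml w hwm)) ((hwmin v₀ hv₀m).trans hv₀x.le) ?_)
      rintro rfl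
      exact (nodup_cons.1 (nodup_cons.1 hndm).2).1 hwm
    obtain ⟨l', hp, hch, hK⟩ := ih m.length (by rw [← hm.length_eq]; simp) m
      (nodup_cons.1 (nodup_cons.1 hndm).2).2 hmc w hwm hwmin rfl
    refine ⟨x :: w :: l', ((hp.cons x).cons u).trans hm,
      isChain_cons_cons.2 ⟨hux, isChain_cons_cons.2 ⟨hxw, hch⟩⟩, ?_⟩
    intro K hKl hun C D hCD v hv
    cases C with
    | nil => simp at hv
    | cons c C =>
      obtain ⟨rfl, hCD₁⟩ : u = c ∧ x :: w :: l' = C ++ K :: D := cons.inj hCD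
      rcases mem_cons.1 hv with rfl | hv
      · exact hmin K hKl
      cases C with
      | nil => simp at hv
      | cons c' C =>
        obtain ⟨rfl, hCD₂⟩ : x = c' ∧ w :: l' = C ++ K :: D := cons.inj hCD₁
        have hKm : K ∈ m := hp.mem_iff.1 (by rw [hCD₂]; simp)
        rcases mem_cons.1 hv with rfl | hv
        · refine huK K hKl ?_ hun
          rintro rfl
          exact (nodup_cons.1 hndm).1 (by simp [hKm])
        · exact hK K hKm (fun y hy => hun y (hml y hy)) C D hCD₂ v hv

end List

/-! ### Longest paths, domination and lifts of arcs. -/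

namespace SimpleGraph

variable {V : Type*} {G : SimpleGraph V}

/-- The vertex list of a path with the largest possible number of vertices. -/
structure IsLongestList (G : SimpleGraph V) (P : List V) : Prop where
  nodup : P.Nodup
  chain : P.IsChain G.Adj
  length_le : ∀ Q : List V, Q.Nodup → Q.IsChain G.Adj → Q.length ≤ P.length

theorem IsLongestList.mem_of_insert {A B : List V} {K : V} (hP : G.IsLongestList (A ++ B))
    (hA : ∀ a ∈ A.getLast?, G.Adj a K) (hB : ∀ b ∈ B.head?, G.Adj K b) : K ∈ A ++ B := by
  by_contra hK
  obtain ⟨h1, h2, -⟩ := List.isChain_append.1 hP.chain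
  have := hP.length_le (A ++ K :: B)
    (List.perm_middle.nodup_iff.2 (List.nodup_cons.2 ⟨hK, hP.nodup⟩))
    (List.isChain_append.2 ⟨h1, List.isChain_cons.2 ⟨hB, h2⟩, by simpa using hA⟩)
  simp at this

/-- The closed neighbourhood of `u` is contained in that of `v`. -/
def Dominates (G : SimpleGraph V) (v u : V) : Prop :=
  ∀ w, w = u ∨ G.Adj w u → w = v ∨ G.Adj w v

/-- Otherwise `v` could be inserted right after `u`. -/
theorem IsLongestList.mem_of_dominates {P : List V} {u v : V} (hP : G.IsLongestList P)
    (hu : u ∈ P) (h : G.Dominates v u) : v ∈ P := by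
  by_contra hv
  obtain ⟨A, B, rfl⟩ := List.append_of_mem hu
  have hne : ∀ w ∈ A ++ u :: B, w ≠ v := fun w hw hwv => hv (hwv ▸ hw)
  have hP' : G.IsLongestList ((A ++ [u]) ++ B) := by simpa using hP
  suffices hmem : v ∈ (A ++ [u]) ++ B from hv (by simpa using hmem)
  refine hP'.mem_of_insert ?_ ?_
  · simpa using (h u (.inl rfl)).resolve_left (hne u (by simp))
  · intro b hb
    have hbu : G.Adj b u := ((List.isChain_append.1 hP'.chain).2.2 u (by simp) b hb).symm
    exact ((h b (.inr hbu)).resolve_left (hne b (by simp [List.mem_of_head? hb]))).symm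

theorem IsLongestList.isChain_of_notMem {P : List V} {K : V} (hP : G.IsLongestList P)
    (hK : K ∉ P) : P.IsChain fun a b => G.Adj a b ∧ ¬ (G.Adj a K ∧ G.Adj b K) := by
  rw [List.isChain_iff_forall_rel_of_append_cons_cons]
  intro a b A B h
  subst h
  refine ⟨(List.isChain_append_cons_cons.1 hP.chain).2.1, fun hab => hK ?_⟩
  have hP' : G.IsLongestList ((A ++ [a]) ++ b :: B) := by simpa using hP
  simpa using hP'.mem_of_insert (K := K) (by simpa using hab.1) (by simpa using hab.2.symm)

/-- `G` is the intersection graph of the arcs `(l v, r v)` modulo `1`. -/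
structure IsArcModel (G : SimpleGraph V) (l r : V → ℝ) : Prop where
  lt : ∀ v, l v < r v
  adj_iff : ∀ u w, u ≠ w → (G.Adj u w ↔ ∃ m : ℤ, l u < r w + m ∧ l w + m < r u)

/-- Containment of arcs modulo `1`, witnessed by lifts. -/
def ArcLE (l r : V → ℝ) (u v : V) : Prop :=
  ∃ m : ℤ, l v ≤ l u + m ∧ r u + m ≤ r v

/-- An arc that is maximal with respect to containment. -/
def IsMaxArc (l r : V → ℝ) (u : V) : Prop :=
  ∀ v, ArcLE l r u v → ArcLE l r v u

variable {l r : V → ℝ}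

theorem IsArcModel.reflect (h : G.IsArcModel l r) : G.IsArcModel (-r) (-l) := by
  refine ⟨fun v => by simpa using h.lt v, fun u w huw => (h.adj_iff u w huw).trans ?_⟩
  constructor <;> rintro ⟨m, h1, h2⟩ <;> refine ⟨-m, ?_, ?_⟩ <;>
    simp only [Pi.neg_apply, Int.cast_neg] at * <;> linarith

theorem arcLE_reflect {u v : V} : ArcLE (-r) (-l) u v ↔ ArcLE l r u v := by
  constructor <;> rintro ⟨m, h1, h2⟩ <;> refine ⟨-m, ?_, ?_⟩ <;>
    simp only [Pi.neg_apply, Int.cast_neg] at * <;> linarith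

theorem isMaxArc_reflect {u : V} : IsMaxArc (-r) (-l) u ↔ IsMaxArc l r u := by
  simp only [IsMaxArc, arcLE_reflect]

theorem ArcLE.trans {u v w : V} (h : ArcLE l r u v) (h' : ArcLE l r v w) : ArcLE l r u w := by
  obtain ⟨m, h1, h2⟩ := h
  obtain ⟨n, h3, h4⟩ := h'
  exact ⟨m + n, by push_cast; linarith, by push_cast; linarith⟩

theorem ArcLE.refl (u : V) : ArcLE l r u u := ⟨0, by simp, by simp⟩

theorem IsArcModel.dominates (h : G.IsArcModel l r) {u v : V} (huv : ArcLE l r u v) :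
    G.Dominates v u := by
  intro w hw
  by_cases hwv : w = v
  · exact .inl hwv
  refine .inr ((h.adj_iff w v hwv).2 ?_)
  obtain ⟨m, h1, h2⟩ := huv
  rcases hw with rfl | hw
  · have := h.lt w
    exact ⟨-m, by push_cast; linarith, by push_cast; linarith⟩
  · obtain ⟨n, h3, h4⟩ := (h.adj_iff w u hw.ne).1 hw
    exact ⟨n - m, by push_cast; linarith, by push_cast; linarith⟩

/-- Every arc lies in a maximal one. -/
theorem exists_isMaxArc [Finite V] (l r : V → ℝ) (v : V) :
    ∃ w, ArcLE l r v w ∧ IsMaxArc l r w := by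
  obtain ⟨w, hw, hmax⟩ := Set.exists_max_image {w | ArcLE l r v w} (fun w => r w - l w)
    (Set.toFinite _) ⟨v, ArcLE.refl v⟩
  refine ⟨w, hw, fun x hx => ?_⟩
  have hlen : r x - l x ≤ r w - l w := hmax x (ArcLE.trans hw hx)
  obtain ⟨m, h1, h2⟩ := hx
  exact ⟨-m, by push_cast; linarith, by push_cast; linarith⟩

theorem IsArcModel.dominates_of_long (h : G.IsArcModel l r) {v : V} (hv : l v + 1 < r v) (u : V) :
    G.Dominates v u := by
  intro w _
  by_cases hwv : w = v
  · exact .inl hwv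
  refine .inr ((h.adj_iff v w (Ne.symm hwv)).2 ⟨⌈l v - l w⌉, ?_, ?_⟩).symm
  · have := Int.le_ceil (l v - l w)
    linarith [h.lt w]
  · have := Int.ceil_lt_add_one (l v - l w)
    linarith

/-- A lift of the arc of `v` that meets the complement `[r K - 1, l K]` of the arc of `K`. -/
def IsLift (l r : V → ℝ) (K v : V) (m : ℤ) : Prop :=
  l v + m < l K ∧ r K - 1 < r v + m

/-- Take the last translate starting left of `K`. If it ended by `r K - 1`, the next one would lie
inside `K`. -/
theorem exists_isLift {K v : V} (h : ¬ ArcLE l r v K) : ∃ m, IsLift l r K v m := by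
  refine ⟨⌈l K - l v⌉ - 1, ?_, ?_⟩
  · have := Int.ceil_lt_add_one (l K - l v)
    push_cast
    linarith
  · by_contra hr
    push_cast at hr
    refine h ⟨⌈l K - l v⌉, ?_, ?_⟩
    · have := Int.le_ceil (l K - l v)
      linarith
    · linarith

/-- If `m < n`, the translate by `n` starts before `K` and ends after it, against maximality. -/
theorem IsLift.le {K v : V} (hK : IsMaxArc l r K) (h : ¬ ArcLE l r v K) {m n : ℤ}
    (hm : IsLift l r K v m) (hn : IsLift l r K v n) : n ≤ m := by
  by_contra! hlt
  have : (m : ℝ) + 1 ≤ n := by exact_mod_cast hlt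
  exact h (hK v ⟨-n, by push_cast; linarith [hn.1], by push_cast; linarith [hm.2]⟩)

theorem IsLift.eq {K v : V} (hK : IsMaxArc l r K) (h : ¬ ArcLE l r v K) {m n : ℤ}
    (hm : IsLift l r K v m) (hn : IsLift l r K v n) : m = n :=
  le_antisymm (hn.le hK h hm) (hm.le hK h hn)

/-- A longest path avoiding the maximal arc `K'` but containing an arc `K` that overlaps `K'` on
the left can be rearranged so that all vertices before the first neighbour of `K'` lie in `K`. -/
theorem IsLongestList.exists_perm_of_overlap_left {P : List V} {K K' : V} (h : G.IsArcModel l r)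
    (hP : G.IsLongestList P) (hK : K ∈ P) (hK' : K' ∉ P) (hmax : IsMaxArc l r K')
    (hadj : G.Adj K K') {j : ℤ} (hj₁ : l K + j < l K') (hj₂ : l K' < r K + j) :
    ∃ C e X, (C ++ e :: X).Perm P ∧ (C ++ e :: X).IsChain G.Adj ∧ G.Adj e K' ∧
      ∀ v ∈ C, ¬ G.Adj v K' ∧ ArcLE l r v K := by
  have hshort : r K' - 1 ≤ l K' := by
    by_contra! hlong
    exact hK' (hP.mem_of_dominates hK (h.dominates_of_long (by linarith) K))
  have hnot : ∀ v ∈ P, ¬ ArcLE l r v K' := fun v hv hle =>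
    hK' (hP.mem_of_dominates hv (h.dominates hle))
  have hex : ∀ v, ∃ m : ℤ, v ∈ P → IsLift l r K' v m := fun v => by
    by_cases hv : v ∈ P
    · obtain ⟨m, hm⟩ := exists_isLift (hnot v hv)
      exact ⟨m, fun _ => hm⟩
    · exact ⟨0, fun hv' => absurd hv' hv⟩
  choose m hm using hex
  have hmK : m K = j := (hm K hK).eq hmax (hnot K hK) ⟨hj₁, by linarith⟩
  have hinside : ∀ v ∈ P, ¬ G.Adj v K' → r v + m v ≤ l K' ∧ r K' - 1 ≤ l v + m v := by
    intro v hv hna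
    have hvK : v ≠ K' := fun hv' => hK' (hv' ▸ hv)
    rw [h.adj_iff v K' hvK] at hna
    push Not at hna
    obtain ⟨h1, h2⟩ := hm v hv
    have h3 := h.lt K'
    constructor
    · have := hna (-m v) (by push_cast; linarith)
      push_cast at this
      linarith
    · by_contra! hlt
      have := hna (-1 - m v) (by push_cast; linarith)
      push_cast at this
      linarith
  -- The interval graph of the lifts. Of two consecutive vertices of `P`, one is not adjacent to
  -- `K'`; its lift lies in the gap left by `K'`, so their arcs meet there and `P` remains a path.
  let R : V → V → Prop := fun v w =>
    v ≠ w ∧ l v + m v < r w + m w ∧ l w + m w < r v + m v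
  have hs : ∀ a b, R a b → R b a := fun a b hab => ⟨hab.1.symm, hab.2.2, hab.2.1⟩
  have hkey : List.IsIntervalKey R fun v => -(l v + m v) := by
    rintro a b c ⟨-, h1, h2⟩ h3 h4 hbc
    have := h.lt b
    simp only [neg_le_neg_iff] at h3 h4
    exact ⟨hbc, by linarith, by linarith⟩
  have hRadj : ∀ a b, R a b → G.Adj a b := by
    rintro a b ⟨hab, h1, h2⟩
    exact (h.adj_iff a b hab).2 ⟨m b - m a, by push_cast; linarith, by push_cast; linarith⟩
  have hRof : ∀ a ∈ P, ∀ b ∈ P, G.Adj a b → ¬ G.Adj a K' → R a b := by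
    intro a ha b hb hab hna
    obtain ⟨n, h1, h2⟩ := (h.adj_iff a b hab.ne).1 hab
    obtain ⟨h3, h4⟩ := hinside a ha hna
    have : m b = n + m a := (hm b hb).eq hmax (hnot b hb)
      ⟨by push_cast; linarith, by push_cast; linarith⟩
    refine ⟨hab.ne, ?_, ?_⟩ <;> rw [this] <;> push_cast <;> linarith
  have hchain : P.IsChain R := by
    have := hP.isChain_of_notMem hK'
    rw [List.isChain_iff_forall_rel_of_append_cons_cons] at this ⊢
    intro a b A B hAB
    obtain ⟨hab, hn⟩ := this hAB
    have ha : a ∈ P := by simp [hAB]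
    have hb : b ∈ P := by simp [hAB]
    by_cases haK : G.Adj a K'
    · exact hs _ _ (hRof b hb a ha hab.symm fun hbK => hn ⟨haK, hbK⟩)
    · exact hRof a ha b hb hab haK
  obtain ⟨u, hu, humin⟩ := Set.exists_min_image {v | v ∈ P} (fun v => -(l v + m v))
    P.finite_toSet ⟨K, hK⟩
  obtain ⟨L, hperm, hLchain, hL⟩ := List.IsChain.exists_perm_sorted hkey hs
    (fun a ha => ha.1 rfl) P hP.nodup hchain u hu humin
  -- Every lift starts before `l K'`, which the lift of `K` passes, so `K` meets all lifts starting
  -- no earlier than its own.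
  have hLK := hL K hK fun v hv hvK hle => by
    have := h.lt v
    have := (hm v hv).1
    simp only [neg_le_neg_iff] at hle
    refine ⟨hvK.symm, by linarith, ?_⟩
    rw [hmK]
    linarith
  have hKL : K ∈ u :: L := hperm.mem_iff.2 hK
  obtain ⟨C, e, X, hsplit, he, hC⟩ : ∃ C e X, u :: L = C ++ e :: X ∧ G.Adj e K' ∧
      ∀ v ∈ C, ¬ G.Adj v K' := by
    classical
    obtain ⟨e, he⟩ := Option.isSome_iff_exists.1
      ((List.find?_isSome (p := fun v => decide (G.Adj v K'))).2 ⟨K, hKL, by simpa using hadj⟩)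
    obtain ⟨h1, C, X, h2, h3⟩ := List.find?_eq_some_iff_append.1 he
    exact ⟨C, e, X, h2, by simpa using h1, fun v hv => by simpa using h3 v hv⟩
  rw [hsplit] at hperm hLchain hKL hLK
  refine ⟨C, e, X, hperm, hLchain.imp hRadj, he, fun v hv => ⟨hC v hv, ?_⟩⟩
  have hvP : v ∈ P := hperm.mem_iff.1 (by simp [hv])
  have hKX : K ∈ e :: X := by
    rcases List.mem_append.1 hKL with hKC | hKX
    · exact absurd hadj (hC K hKC)
    · exact hKX
  -- Vertices of `C` precede `K`, so they start no earlier than `K`; being in the gap, they end by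
  -- `l K'`.
  obtain ⟨D, B, hDB⟩ := List.append_of_mem hKX
  have h1 := hLK (C ++ D) B (by rw [hDB, List.append_assoc]) v (by simp [hv])
  have h2 := (hinside v hvP (hC v hv)).1
  simp only [neg_le_neg_iff] at h1
  rw [hmK] at h1
  exact ⟨m v - j, by push_cast; linarith, by push_cast; linarith⟩

/-- `K` sticks out of `K'` on some side; reflection reduces the right side to the left. -/
theorem IsLongestList.exists_perm_of_overlap {P : List V} {K K' : V} (h : G.IsArcModel l r)
    (hP : G.IsLongestList P) (hK : K ∈ P) (hK' : K' ∉ P) (hmax : IsMaxArc l r K')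
    (hadj : G.Adj K K') :
    ∃ C e X, (C ++ e :: X).Perm P ∧ (C ++ e :: X).IsChain G.Adj ∧ G.Adj e K' ∧
      ∀ v ∈ C, ¬ G.Adj v K' ∧ ArcLE l r v K := by
  have hnot : ¬ ArcLE l r K K' := fun hle => hK' (hP.mem_of_dominates hK (h.dominates hle))
  obtain ⟨j, h1, h2⟩ := (h.adj_iff K' K hadj.ne').1 hadj.symm
  rcases lt_or_ge (l K + j) (l K') with hlt | hge
  · exact hP.exists_perm_of_overlap_left h hK hK' hmax hadj hlt h1
  · have hr : r K' < r K + j := by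
      by_contra! hle
      exact hnot ⟨j, hge, hle⟩
    have := hP.exists_perm_of_overlap_left h.reflect hK hK' (isMaxArc_reflect.2 hmax) hadj
      (j := -j) (by simp only [Pi.neg_apply, Int.cast_neg]; linarith)
      (by simp only [Pi.neg_apply, Int.cast_neg]; linarith)
    simpa only [arcLE_reflect] using this

end SimpleGraph

/-! ### Detours along a sequence of maximal arcs. -/

namespace SimpleGraph

variable {V : Type*} {G : SimpleGraph V} {l r : V → ℝ}

theorem exists_nodup_chain_of_seq {K : ℕ → V} (hK : ∀ i, K i = K (i + 1) ∨ G.Adj (K i) (K (i + 1)))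
    (b n : ℕ) : ∃ W : List V, W.Nodup ∧ W.IsChain G.Adj ∧ W.head? = some (K b) ∧
      W.getLast? = some (K (b + n)) ∧ ∀ w ∈ W, ∃ i, b ≤ i ∧ i ≤ b + n ∧ w = K i := by
  induction n with
  | zero => exact ⟨[K b], by simp, by simp, by simp, by simp, by simpa using ⟨b, by simp⟩⟩
  | succ n ih =>
    obtain ⟨W, hnd, hc, hh, hl, hW⟩ := ih
    -- A repeated term is handled by truncating the list at its earlier occurrence.
    by_cases hmem : K (b + (n + 1)) ∈ W
    · obtain ⟨A, B, rfl⟩ := List.append_of_mem hmem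
      have hsub : ∀ w ∈ A ++ [K (b + (n + 1))], w ∈ A ++ K (b + (n + 1)) :: B := by
        intro w hw
        simp only [List.mem_append, List.mem_cons, List.not_mem_nil, or_false] at hw ⊢
        tauto
      have heq : A ++ K (b + (n + 1)) :: B = (A ++ [K (b + (n + 1))]) ++ B := by simp
      rw [heq] at hnd hc hh
      refine ⟨A ++ [K (b + (n + 1))], hnd.of_append_left, hc.left_of_append, ?_, by simp, ?_⟩
      · cases A <;> simpa using hh
      · intro w hw
        obtain ⟨i, h1, h2, h3⟩ := hW w (hsub w hw)
        exact ⟨i, h1, by omega, h3⟩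
    · have hadj : G.Adj (K (b + n)) (K (b + (n + 1))) := by
        refine (hK (b + n)).resolve_left fun heq => hmem ?_
        rw [← Nat.add_assoc, ← heq]
        exact List.mem_of_getLast? hl
      refine ⟨W ++ [K (b + (n + 1))], ?_, ?_, ?_, by simp, ?_⟩
      · refine List.nodup_append.2 ⟨hnd, by simp, ?_⟩
        rintro a ha c hc rfl
        exact hmem (List.mem_singleton.1 hc ▸ ha)
      · exact List.isChain_append.2 ⟨hc, by simp, by simpa [hl] using hadj⟩
      · simp [List.head?_append, hh]
      · intro w hw
        rcases List.mem_append.1 hw with hw | hw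
        · obtain ⟨i, h1, h2, h3⟩ := hW w hw
          exact ⟨i, h1, by omega, h3⟩
        · exact ⟨b + (n + 1), by omega, le_rfl, by simpa using hw⟩

/-- Replacing the initial segment `C` of a longest path by a detour `W` followed by `C'`. -/
theorem IsLongestList.length_lt_of_detour {P Q C C' X W : List V} {e k k' : V}
    (h : G.IsArcModel l r) (hP : G.IsLongestList P) (hCP : (C ++ e :: X).Perm P)
    (hC : (C ++ e :: X).IsChain G.Adj) (he : G.Adj e k') (hWnd : W.Nodup) (hWc : W.IsChain G.Adj)
    (hWh : W.head? = some k') (hWl : W.getLast? = some k) (hWP : ∀ w ∈ W, w ∉ P)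
    (hWQ : ∀ w ∈ W, w ≠ k → w ∉ Q) (hC'nd : C'.Nodup) (hC'c : C'.IsChain G.Adj)
    (hC'Q : ∀ v ∈ C', v ∈ Q) (hC'k : ∀ v ∈ C', v ≠ k ∧ ArcLE l r v k) :
    C'.length < C.length := by
  have hkW : k ∈ W := List.mem_of_getLast? hWl
  have hC'P : ∀ v ∈ C', v ∉ P := fun v hv hvP =>
    hWP k hkW (hP.mem_of_dominates hvP (h.dominates (hC'k v hv).2))
  have hC'W : ∀ v ∈ C', v ∉ W := fun v hv hvW => hWQ v hvW (hC'k v hv).1 (hC'Q v hv)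
  have hXP : ∀ v ∈ e :: X, v ∈ P := fun v hv => hCP.mem_iff.1 (List.mem_append_right C hv)
  -- The competing path: `X` backwards, `e`, then `W` from `k'` to `k`, then `C'`.
  have hnd : ((e :: X).reverse ++ (W ++ C')).Nodup := by
    have h1 : (e :: X).Nodup := (hCP.nodup_iff.2 hP.nodup).of_append_right
    refine List.nodup_append.2 ⟨List.nodup_reverse.2 h1, List.nodup_append.2 ⟨hWnd, hC'nd, ?_⟩, ?_⟩
    · rintro a ha b hb rfl
      exact hC'W a hb ha
    · rintro a ha b hb rfl
      have haP := hXP a (List.mem_reverse.1 ha)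
      rcases List.mem_append.1 hb with hb | hb
      · exact hWP a hb haP
      · exact hC'P a hb haP
  have hch : ((e :: X).reverse ++ (W ++ C')).IsChain G.Adj := by
    refine List.isChain_append.2 ⟨List.isChain_reverse_of_symm (fun _ _ hab => hab.symm)
      (List.isChain_append.1 hC).2.1, List.isChain_append.2 ⟨hWc, hC'c, ?_⟩, ?_⟩
    · intro a ha c hc
      have hak : k = a := by simpa [hWl] using ha
      subst hak
      have hcC := List.mem_of_head? hc
      exact ((h.dominates (hC'k c hcC).2 c (.inl rfl)).resolve_left (hC'k c hcC).1).symm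
    · intro a ha b hb
      have hae : e = a := by simpa using ha
      have hbk : k' = b := by simpa [List.head?_append, hWh] using hb
      rwa [← hae, ← hbk]
  have h1 := hP.length_le _ hnd hch
  have h2 := hCP.length_eq
  have h3 := List.length_pos_of_mem hkW
  simp only [List.length_append, List.length_reverse, List.length_cons] at h1 h2
  omega

/-- Along a sequence of maximal arcs, no longest path can stop at `K b` while another one starts
at `K (b + n + 1)`. -/
theorem IsLongestList.false_of_separated {P Q : List V} (h : G.IsArcModel l r)
    (hP : G.IsLongestList P) (hQ : G.IsLongestList Q) {K : ℕ → V}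
    (hK : ∀ i, K i = K (i + 1) ∨ G.Adj (K i) (K (i + 1))) (hmax : ∀ i, IsMaxArc l r (K i))
    {b n : ℕ} (hbP : K b ∈ P) (hP' : ∀ i, b < i → i ≤ b + n + 1 → K i ∉ P)
    (haQ : K (b + n + 1) ∈ Q) (hQ' : ∀ i, b ≤ i → i ≤ b + n → K i ∉ Q) : False := by
  have hadjP : G.Adj (K b) (K (b + 1)) := (hK b).resolve_left fun heq =>
    hP' (b + 1) (by omega) (by omega) (heq ▸ hbP)
  have hadjQ : G.Adj (K (b + n + 1)) (K (b + n)) := ((hK (b + n)).resolve_left fun heq =>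
    hQ' (b + n) (by omega) le_rfl (heq ▸ haQ)).symm
  obtain ⟨C, e, X, hCP, hCc, he, hC⟩ := hP.exists_perm_of_overlap h hbP
    (hP' (b + 1) (by omega) (by omega)) (hmax _) hadjP
  obtain ⟨D, f, Y, hDQ, hDc, hf, hD⟩ := hQ.exists_perm_of_overlap h haQ
    (hQ' (b + n) (by omega) le_rfl) (hmax _) hadjQ
  have hCne : ∀ v ∈ C, v ≠ K b ∧ ArcLE l r v (K b) := fun v hv =>
    ⟨fun hvb => (hC v hv).1 (hvb ▸ hadjP), (hC v hv).2⟩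
  have hDne : ∀ v ∈ D, v ≠ K (b + n + 1) ∧ ArcLE l r v (K (b + n + 1)) := fun v hv =>
    ⟨fun hvb => (hD v hv).1 (hvb ▸ hadjQ), (hD v hv).2⟩
  have hlt₁ : D.length < C.length := by
    obtain ⟨W, hnd, hc, hh, hl, hW⟩ := exists_nodup_chain_of_seq hK (b + 1) n
    rw [Nat.add_right_comm] at hl
    refine hP.length_lt_of_detour (Q := Q) h hCP hCc he hnd hc hh hl ?_ ?_
      (hDQ.nodup_iff.2 hQ.nodup).of_append_left hDc.left_of_append
      (fun v hv => hDQ.mem_iff.1 (List.mem_append_left _ hv)) hDne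
    · intro w hw
      obtain ⟨i, h1, h2, rfl⟩ := hW w hw
      exact hP' i (by omega) (by omega)
    · intro w hw hne
      obtain ⟨i, h1, h2, rfl⟩ := hW w hw
      have : i ≠ b + n + 1 := fun hi => hne (by rw [hi])
      exact hQ' i (by omega) (by omega)
  have hlt₂ : C.length < D.length := by
    obtain ⟨W, hnd, hc, hh, hl, hW⟩ := exists_nodup_chain_of_seq hK b n
    refine hQ.length_lt_of_detour (Q := P) h hDQ hDc hf (List.nodup_reverse.2 hnd)
      (List.isChain_reverse_of_symm (fun _ _ hab => hab.symm) hc) (by simpa using hl)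
      (by simpa using hh) ?_ ?_
      (hCP.nodup_iff.2 hP.nodup).of_append_left hCc.left_of_append
      (fun v hv => hCP.mem_iff.1 (List.mem_append_left _ hv)) hCne
    · intro w hw
      obtain ⟨i, h1, h2, rfl⟩ := hW w (List.mem_reverse.1 hw)
      exact hQ' i h1 h2
    · intro w hw hne
      obtain ⟨i, h1, h2, rfl⟩ := hW w (List.mem_reverse.1 hw)
      have : i ≠ b := fun hi => hne (by rw [hi])
      exact hP' i (by omega) (by omega)
  omega

theorem Connected.exists_walk_support [Finite V] (hG : G.Connected) :
    ∃ (x y : V) (p : G.Walk x y), ∀ v, v ∈ p.support := by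
  classical
  have := Fintype.ofFinite V
  obtain ⟨x⟩ := hG.nonempty
  suffices hs : ∀ s : Finset V, ∃ (y : V) (p : G.Walk x y), ∀ v ∈ s, v ∈ p.support by
    obtain ⟨y, p, hp⟩ := hs Finset.univ
    exact ⟨x, y, p, fun v => hp v (Finset.mem_univ v)⟩
  intro s
  induction s using Finset.induction_on with
  | empty => exact ⟨x, .nil, by simp⟩
  | insert a s _ ih =>
    obtain ⟨y, p, hp⟩ := ih
    obtain ⟨q⟩ := hG.preconnected y a
    refine ⟨a, p.append q, fun v hv => ?_⟩
    rw [Walk.mem_support_append_iff]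
    rcases Finset.mem_insert.1 hv with rfl | hv
    · exact .inr q.end_mem_support
    · exact .inl (hp v hv)

theorem IsArcModel.exists_mem_of_isLongestList [Finite V] (h : G.IsArcModel l r)
    (hG : G.Connected) : ∃ v, ∀ P, G.IsLongestList P → v ∈ P := by
  classical
  obtain ⟨x, y, p, hp⟩ := hG.exists_walk_support
  by_cases hex : ∃ P, G.IsLongestList P
  swap
  · exact ⟨x, fun P hP => absurd ⟨P, hP⟩ hex⟩
  obtain ⟨P₀, hP₀⟩ := hex
  choose top htop hmaxtop using exists_isMaxArc l r
  set K : ℕ → V := fun i => top (p.getVert i) with hKdef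
  have hK : ∀ i, K i = K (i + 1) ∨ G.Adj (K i) (K (i + 1)) := by
    intro i
    rcases lt_or_ge i p.length with hi | hi
    · have hadj := p.adj_getVert_succ hi
      have h1 : p.getVert i = K (i + 1) ∨ G.Adj (p.getVert i) (K (i + 1)) :=
        h.dominates (htop _) _ (.inr hadj)
      have h2 : K (i + 1) = K i ∨ G.Adj (K (i + 1)) (K i) :=
        h.dominates (htop _) _ (h1.imp Eq.symm Adj.symm)
      exact h2.imp Eq.symm Adj.symm
    · left
      simp only [hKdef]
      rw [p.getVert_of_length_le hi, p.getVert_of_length_le (by omega)]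
  have hhit : ∀ P, G.IsLongestList P → ∃ i ≤ p.length, K i ∈ P := by
    intro P hP
    have hne : P ≠ [] := by
      rintro rfl
      simpa using hP.length_le [x] (by simp) (by simp)
    obtain ⟨v, hv⟩ := List.exists_mem_of_ne_nil P hne
    obtain ⟨i, rfl, hi⟩ := Walk.mem_support_iff_exists_getVert.1 (hp v)
    exact ⟨i, hi, hP.mem_of_dominates hv (h.dominates (htop _))⟩
  -- Minimality of the least `b` with `S b` forces every longest path to meet the sequence at some
  -- index from `b` on.
  let S : ℕ → Prop := fun b => ∃ P, G.IsLongestList P ∧ ∀ i, b < i → i ≤ p.length → K i ∉ P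
  have hS : ∃ b, S b := ⟨p.length, P₀, hP₀, fun i h1 h2 => by omega⟩
  obtain ⟨P, hP, hPb⟩ := Nat.find_spec hS
  have hfirst : ∀ Q, G.IsLongestList Q → ∃ i, Nat.find hS ≤ i ∧ i ≤ p.length ∧ K i ∈ Q := by
    intro Q hQ
    by_contra! hcon
    rcases Nat.eq_zero_or_pos (Nat.find hS) with h0 | hpos
    · obtain ⟨i, hi, hiQ⟩ := hhit Q hQ
      exact hcon i (by omega) hi hiQ
    · exact Nat.find_min hS (m := Nat.find hS - 1) (by omega)
        ⟨Q, hQ, fun i h1 h2 => hcon i (by omega) h2⟩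
  have hbP : K (Nat.find hS) ∈ P := by
    obtain ⟨i, h1, h2, h3⟩ := hfirst P hP
    rcases h1.eq_or_lt with heq | hlt
    · rwa [heq]
    · exact absurd h3 (hPb i hlt h2)
  refine ⟨K (Nat.find hS), fun Q hQ => ?_⟩
  by_contra hbQ
  have hQex := hfirst Q hQ
  obtain ⟨h1, h2, h3⟩ := Nat.find_spec hQex
  have hne : Nat.find hQex ≠ Nat.find hS := fun heq => hbQ (heq ▸ h3)
  obtain ⟨n, hn⟩ : ∃ n, Nat.find hQex = Nat.find hS + n + 1 :=
    ⟨Nat.find hQex - Nat.find hS - 1, by omega⟩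
  refine hP.false_of_separated h hQ hK (fun i => hmaxtop _) hbP (n := n) ?_ (hn ▸ h3) ?_
  · exact fun i hi hi' => hPb i hi (by omega)
  · exact fun i hi hi' hiQ => Nat.find_min hQex (m := i) (by omega) ⟨hi, by omega, hiQ⟩

/-! ### Passing from arcs and walks to real endpoints and lists. -/

theorem IsCircularArcGraph.exists_isArcModel (h : G.IsCircularArcGraph) :
    ∃ l r : V → ℝ, G.IsArcModel l r := by
  obtain ⟨φ, hφ, hadj⟩ := h
  choose l r hlt heq using hφ
  refine ⟨l, r, hlt, fun u w huw => (hadj u w huw).trans ?_⟩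
  rw [heq, heq]
  constructor
  · rintro ⟨_, ⟨x, hx, rfl⟩, y, hy, hxy⟩
    have h0 : ((x - y : ℝ) : UnitAddCircle) = 0 := by
      rw [AddCircle.coe_sub, sub_eq_zero]
      exact hxy.symm
    obtain ⟨m, hm⟩ := (AddCircle.coe_eq_zero_iff 1).1 h0
    simp only [zsmul_eq_mul, mul_one] at hm
    exact ⟨m, by linarith [hx.1, hy.2], by linarith [hx.2, hy.1]⟩
  · rintro ⟨m, h1, h2⟩
    obtain ⟨x, hx1, hx2⟩ := exists_between (a₁ := max (l u) (l w + m)) (a₂ := min (r u) (r w + m))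
      (max_lt (lt_min (hlt u) h1) (lt_min h2 (by linarith [hlt w])))
    rw [max_lt_iff] at hx1
    rw [lt_min_iff] at hx2
    refine ⟨(x : UnitAddCircle), ⟨x, ⟨hx1.1, hx2.1⟩, rfl⟩, x - m,
      ⟨by linarith [hx1.2], by linarith [hx2.2]⟩, ?_⟩
    have h0 : ((m : ℝ) : UnitAddCircle) = 0 :=
      (AddCircle.coe_eq_zero_iff 1).2 ⟨m, by simp⟩
    show ((x - m : ℝ) : UnitAddCircle) = x
    rw [AddCircle.coe_sub, h0, sub_zero]

theorem Walk.IsLongestPath.isLongestList {x y : V} {p : G.Walk x y} (hp : p.IsLongestPath) :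
    G.IsLongestList p.support := by
  refine ⟨hp.1.support_nodup, p.isChain_adj_support, fun Q hnd hc => ?_⟩
  by_cases hne : Q = []
  · simp [hne]
  have hsup : (Walk.ofSupport Q hne hc).support = Q := Walk.support_ofSupport hne hc
  have := hp.2 _ _ (Walk.ofSupport Q hne hc) ((Walk.isPath_def _).2 (by rwa [hsup]))
  rw [← hsup, Walk.length_support, Walk.length_support]
  omega

end SimpleGraph

theorem mainTheorem1 {V : Type*} [Finite V] (G : SimpleGraph V)
    (hconn : G.Connected) (harc : G.IsCircularArcGraph) :
    ∃ v : V, ∀ (x y : V) (p : G.Walk x y), p.IsLongestPath → v ∈ p.support := by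
  obtain ⟨l, r, h⟩ := harc.exists_isArcModel
  obtain ⟨v, hv⟩ := h.exists_mem_of_isLongestList hconn
  exact ⟨v, fun x y p hp => hv _ hp.isLongestList⟩
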